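/- **Setting.** Let $(M,\omega)$ be $\mathbb R^2$ or a closed surface of genus $g\ge 1$ with an area form, $\varphi$ a symplectomorphism of $(M,\omega)$, and $x$ a hyperbolic fixed point of $\varphi$ whose stable and unstable manifolds $W^s,W^u$ (immersed lines) intersect transversely; assume that $\varphi$ preserves the orientations of $W^s$ and of $W^u$, and fix an orientation $o_u$ of $W^u$. For $p,q\in\mathcal H:=W^s\cap W^u$ let $[p,q]_i$ be the segment from $p$ to $q$ in $W^i$, $i\in\{s,u\}$. A point $p\in\mathcal H$ is *contractible* if the loop that runs through $[x,p]_u$ and back through $[p,x]_s$ is trivial in $\pi_1(M,x)$; $\mathcal H_{[x]}$ is the set of contractible points. *Maslov index.* For $p\in\mathcal H_{[x]}$ choose a disk in $M$ with boundary $[p,x]_u\cup[p,x]_s$ and a positively oriented trivialisation of $TM$ over it, and let $\theta_u$, $\theta_s$ be continuous angles of the lines $TW^u$ along $[p,x]_u$ and $TW^s$ along $[p,x]_s$. Then $$\mu(p):=\Big\lfloor \tfrac{(\theta_u-\theta_s)(x)}{\pi}\Big\rfloor-\Big\lfloor \tfrac{(\theta_u-\theta_s)(p)}{\pi}\Big\rfloor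 ,$$ which is independent of the choices; $\mu(x)=0$. *Signs.* Let $D\subset\mathbb R^2$ be a di-gon, with convex vertices $(\mp1,0)$, lower edge $B_u$ and upper edge $B_s$. Let $\widehat{\mathcal M}(p,q)$ be the set of smooth orientation preserving immersions $v:D\to M$ (immersions also at the boundary and the vertices) with $v(B_u)\subset W^u$, $v(B_s)\subset W^s$, $v(-1,0)=p$, $v(1,0)=q$, modulo orientation preserving diffeomorphisms of $D$ fixing the vertices. Put $n(p,q)=0$ if $\widehat{\mathcal M}(p,q)=\emptyset$; otherwise $n(p,q)=+1$ if the direction from $p$ to $q$ along $[p,q]_u$ agrees with $o_u$, and $n(p,q)=-1$ if not. *Boundary operator.* For a finite set $E\subset\mathcal H_{[x]}$ let $E_k=\{p\in E\mid\mu(p)=k\}$, let $\mathbb ZE$ and $\mathbb ZE_k$ be the free abelian groups on $E$ and $E_k$, and let $\partial^E:\mathbb ZE\to\mathbb ZE$ be the linear map with $$\partial^E p=\sum_{q\in E,\ \mu(q)=\mu(p)-1} n(p,q)\,q ,$$ and $\partial^E_k:\mathbb ZE_k\to\mathbb ZE_{k-1}$ the linear map with $\partial^E_k p=\sum_{q\in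 E_{k-1}}n(p,q)\,q$. The set $E$ is *$\partial$-complete* if $\partial^E\circ\partial^E=0$. **Theorem.** For every finite $\partial$-complete set $E$ of contractible homoclinic points, $(\mathbb ZE,\partial^E)$ is a well-defined chain complex graded by the Maslov index: $\mathbb ZE=\bigoplus_{k\in\mathbb Z}\mathbb ZE_k$, the operator $\partial^E$ maps $\mathbb ZE_k$ to $\mathbb ZE_{k-1}$ and restricts there to $\partial^E_k$, and $\partial^E_{k-1}\circ\partial^E_k=0$ for all $k\in\mathbb Z$. The homology in degree $k$ of the chain complex $(\mathbb ZE_k,\partial^E_k)_{k\in\mathbb Z}$ is $$H_k(E)=\ker\partial^E_k/\operatorname{im}\partial^E_{k+1},$$ and the inclusions $\mathbb ZE_k\subset\mathbb ZE$ induce an isomorphism from $H(E):=\bigoplus_{k\in\mathbb Z}H_k(E)$, the local homoclinic Floer homology of $E$, to $\ker\partial^E/\operatorname{im}\partial^E$. -/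

import Mathlib

open scoped Manifold ContDiff Topology unitInterval DirectSum
open Filter Set Bundle

noncomputable section

namespace HomoclinicFloer

universe u

/-- The Euclidean plane, model space of all surfaces. -/
abbrev Plane : Type := EuclideanSpace ℝ (Fin 2)

section Surfaces

variable (M : Type u) [TopologicalSpace M]

/-- The first singular homology group of `M` with integer coefficients. -/
def H1 : ModuleCat.{u} ℤ :=
  ((AlgebraicTopology.singularHomologyFunctor (ModuleCat.{u} ℤ) 1).obj
    (ModuleCat.of ℤ (ULift.{u} ℤ))).obj (TopCat.of M)

/-- A surface (2-manifold without boundary) is closed of genus `g` if it is compact, connected and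
`H₁(M; ℤ) ≅ ℤ^{2g}`. (All surfaces below carry an area form, hence are oriented.) -/
def IsClosedOfGenus (g : ℕ) : Prop :=
  CompactSpace M ∧ ConnectedSpace M ∧ Nonempty (H1 M ≃ₗ[ℤ] (Fin (2 * g) → ℤ))

/-- `M` is (diffeomorphic to) the plane or a closed surface of genus at least one. -/
def IsPlaneOrClosedOfPosGenus [ChartedSpace Plane M] : Prop :=
  Nonempty (M ≃ₘ⟮𝓡 2, 𝓡 2⟯ Plane) ∨ ∃ g : ℕ, 1 ≤ g ∧ IsClosedOfGenus M g

/-- A symplectic form on a surface: a smooth, alternating, nondegenerate field of bilinear forms on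
the tangent bundle. (Every 2-form on a surface is closed.) -/
structure SymplecticForm [ChartedSpace Plane M] [IsManifold (𝓡 2) ∞ M] where
  /-- the bilinear form on each tangent space -/
  form (m : M) : TangentSpace (𝓡 2) m →L[ℝ] TangentSpace (𝓡 2) m →L[ℝ] ℝ
  alternating (m : M) (v : TangentSpace (𝓡 2) m) : form m v v = 0
  nondegenerate (m : M) (v : TangentSpace (𝓡 2) m) (hv : v ≠ 0) : ∃ w, form m v w ≠ 0
  contMDiff : ContMDiff (𝓡 2) ((𝓡 2).prod 𝓘(ℝ, Plane →L[ℝ] Plane →L[ℝ] ℝ)) ∞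
    (fun m ↦ TotalSpace.mk' (Plane →L[ℝ] Plane →L[ℝ] ℝ)
      (E := fun m : M ↦ TangentSpace (𝓡 2) m →L[ℝ] TangentSpace (𝓡 2) m →L[ℝ] ℝ) m (form m))

end Surfaces

variable {M : Type u} [TopologicalSpace M] [ChartedSpace Plane M]

section Dynamics

/-- `φ` preserves `Ω`, that is, `φ^* Ω = Ω`. -/
def IsSymplecto [IsManifold (𝓡 2) ∞ M] (Ω : SymplecticForm M) (φ : M ≃ₘ⟮𝓡 2, 𝓡 2⟯ M) : Prop :=
  ∀ (m : M) (v w : TangentSpace (𝓡 2) m),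
    Ω.form (φ m) (mfderiv (𝓡 2) (𝓡 2) φ m v) (mfderiv (𝓡 2) (𝓡 2) φ m w) = Ω.form m v w

/-- The derivative of `φ` at `x`, as an endomorphism of the model plane. It is only used when
`φ x = x`; then source and target are the same tangent space, read in the same chart. -/
def derivAt (φ : M ≃ₘ⟮𝓡 2, 𝓡 2⟯ M) (x : M) : Plane →L[ℝ] Plane :=
  mfderiv (𝓡 2) (𝓡 2) φ x

/-- `x` is a fixed point of `φ` and no complex eigenvalue of `Dφ(x)` has modulus one. -/
def IsHyperbolicFixedPoint (φ : M ≃ₘ⟮𝓡 2, 𝓡 2⟯ M) (x : M) : Prop :=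
  φ x = x ∧ ∀ z : ℂ,
    ((derivAt φ x : Plane →ₗ[ℝ] Plane).charpoly.map (algebraMap ℝ ℂ)).IsRoot z → ‖z‖ ≠ 1

/-- The stable manifold `{p | φⁿ(p) → x as n → ∞}`. -/
def stableManifold (φ : M ≃ₘ⟮𝓡 2, 𝓡 2⟯ M) (x : M) : Set M :=
  {p | Tendsto (fun n : ℕ ↦ φ^[n] p) atTop (𝓝 x)}

/-- The unstable manifold `{p | φⁿ(p) → x as n → -∞}`. -/
def unstableManifold (φ : M ≃ₘ⟮𝓡 2, 𝓡 2⟯ M) (x : M) : Set M :=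
  {p | Tendsto (fun n : ℕ ↦ φ.symm^[n] p) atTop (𝓝 x)}

/-- The set of homoclinic points, which contains `x` itself. -/
def homoclinic (φ : M ≃ₘ⟮𝓡 2, 𝓡 2⟯ M) (x : M) : Set M :=
  stableManifold φ x ∩ unstableManifold φ x

/-- `γ` parametrises the set `W` as an injectively immersed line through `x = γ 0`, in such a way
that `f` becomes a homeomorphism `h` of the line all of whose orbits tend to `0`. For `W` the stable
manifold of `f` at `x` this is a parametrisation of `W` by the real line with respect to its
intrinsic smooth structure (not the topology induced from the surface). -/
structure IsContractedLine (f : M ≃ₘ⟮𝓡 2, 𝓡 2⟯ M) (x : M) (W : Set M) (γ : ℝ → M) : Prop where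
  smooth : ContMDiff 𝓘(ℝ, ℝ) (𝓡 2) ∞ γ
  immersion : ∀ t, Function.Injective (mfderiv 𝓘(ℝ, ℝ) (𝓡 2) γ t)
  injective : Function.Injective γ
  range_eq : range γ = W
  map_zero : γ 0 = x
  conj : ∃ h : ℝ ≃ₜ ℝ, (∀ t, f (γ t) = γ (h t)) ∧ ∀ t, Tendsto (fun n : ℕ ↦ h^[n] t) atTop (𝓝 0)

/-- The set of parametrisations `ℝ → M` of the immersed submanifold `W^s`. -/
def stableParam (φ : M ≃ₘ⟮𝓡 2, 𝓡 2⟯ M) (x : M) : Set (ℝ → M) :=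
  {γ | IsContractedLine φ x (stableManifold φ x) γ}

/-- The set of parametrisations `ℝ → M` of the immersed submanifold `W^u`
(it is contracted by the inverse of `φ`). -/
def unstableParam (φ : M ≃ₘ⟮𝓡 2, 𝓡 2⟯ M) (x : M) : Set (ℝ → M) :=
  {γ | IsContractedLine φ.symm x (unstableManifold φ x) γ}

/-- The velocity `γ'(t)`, as an element of the tangent bundle. -/
def velocity (γ : ℝ → M) (t : ℝ) : TangentBundle (𝓡 2) M :=
  ⟨γ t, mfderiv 𝓘(ℝ, ℝ) (𝓡 2) γ t (1 : ℝ)⟩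

/-- The tangent space at `m` of the immersed curve whose parametrisations form the set `P`. -/
def tangentLine (P : Set (ℝ → M)) (m : M) : Submodule ℝ (TangentSpace (𝓡 2) m) :=
  Submodule.span ℝ {v | ∃ γ ∈ P, ∃ t, velocity γ t = (⟨m, v⟩ : TangentBundle (𝓡 2) M)}

/-- `W^s` and `W^u` intersect transversely: `T_p W^s + T_p W^u = T_p M` at each common point. -/
def TransverseIntersection (φ : M ≃ₘ⟮𝓡 2, 𝓡 2⟯ M) (x : M) : Prop :=
  ∀ p ∈ homoclinic φ x,
    tangentLine (stableParam φ x) p ⊔ tangentLine (unstableParam φ x) p = ⊤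

/-- `φ` preserves the orientations of `W^s` and of `W^u`: written in a parametrisation of either
curve, `φ` is increasing. -/
def IsWOrientationPreserving (φ : M ≃ₘ⟮𝓡 2, 𝓡 2⟯ M) (x : M) : Prop :=
  ∀ γ ∈ stableParam φ x ∪ unstableParam φ x, ∀ h : ℝ → ℝ, (∀ t, φ (γ t) = γ (h t)) → StrictMono h

/-- The path `a` from `p` to `q` runs through the segment `[p, q]` of the immersed curve whose
parametrisations form the set `P`. -/
def IsSegment (P : Set (ℝ → M)) {p q : M} (a : Path p q) : Prop :=
  ∃ γ ∈ P, ∃ s t : ℝ, ∀ r : I, a r = γ ((1 - (r : ℝ)) * s + (r : ℝ) * t)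

/-- `p` is a contractible homoclinic point: the loop `c_p` that runs through `[x, p]_u` and then
back through `[p, x]_s` is trivial in `π₁(M, x)`. -/
def IsContractible (φ : M ≃ₘ⟮𝓡 2, 𝓡 2⟯ M) (x p : M) : Prop :=
  p ∈ homoclinic φ x ∧ ∃ (a : Path x p) (b : Path p x),
    IsSegment (unstableParam φ x) a ∧ IsSegment (stableParam φ x) b ∧
      (a.trans b).Homotopic (Path.refl x)

end Dynamics

section Maslov

variable [IsManifold (𝓡 2) ∞ M]

/-- `k` is the relative Maslov index `μ(p, q)`. Let `a` and `b` run through `[p, q]_u` and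
`[p, q]_s`, and let `F` be a disk with boundary `[p, q]_u ∪ [p, q]_s`, given as a homotopy from `a`
to `b` relative to the end points. Trivialise `F^* TM` by a positively oriented frame `e₁, e₂`
(constant along the two edges of the square that are collapsed to `p` and to `q`). In this
trivialisation the lines `T W^u` along `[p, q]_u` and `T W^s` along `[p, q]_s` have continuous
angles `θu` and `θs`, and the index counts the multiples of `π` that `θu - θs` passes
on the way from `p` to `q`. For perpendicular intersections this is twice the winding number of
the tangent of the loop through `[p, q]_u` and back through `[q, p]_s`, turned by `+90°` at `q` and
by `-90°` at `p`; it is `1` for an immersed di-gon from `p` to `q`. -/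
def IsMaslovIndex (Ω : SymplecticForm M) (φ : M ≃ₘ⟮𝓡 2, 𝓡 2⟯ M) (x p q : M) (k : ℤ) : Prop :=
  ∃ (a b : Path p q) (F : Path.Homotopy a b) (e₁ e₂ : ∀ z : I × I, TangentSpace (𝓡 2) (F z))
    (θu θs : I → ℝ),
    IsSegment (unstableParam φ x) a ∧ IsSegment (stableParam φ x) b ∧
    Continuous (fun z ↦ (⟨F z, e₁ z⟩ : TangentBundle (𝓡 2) M)) ∧
    Continuous (fun z ↦ (⟨F z, e₂ z⟩ : TangentBundle (𝓡 2) M)) ∧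
    (∀ z, 0 < Ω.form (F z) (e₁ z) (e₂ z)) ∧
    (∀ i : I, i = 0 ∨ i = 1 → ∀ s : I,
      (⟨F (s, i), e₁ (s, i)⟩ : TangentBundle (𝓡 2) M) = ⟨F (0, i), e₁ (0, i)⟩ ∧
      (⟨F (s, i), e₂ (s, i)⟩ : TangentBundle (𝓡 2) M) = ⟨F (0, i), e₂ (0, i)⟩) ∧
    Continuous θu ∧ Continuous θs ∧
    (∀ t : I, Real.cos (θu t) • e₁ (0, t) + Real.sin (θu t) • e₂ (0, t) ∈
      tangentLine (unstableParam φ x) (F (0, t))) ∧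
    (∀ t : I, Real.cos (θs t) • e₁ (1, t) + Real.sin (θs t) • e₂ (1, t) ∈
      tangentLine (stableParam φ x) (F (1, t))) ∧
    k = ⌊(θu 1 - θs 1) / Real.pi⌋ - ⌊(θu 0 - θs 0) / Real.pi⌋

open Classical in
/-- The Maslov index `μ(p) = μ(p, x)` of a contractible homoclinic point `p`. The index does not
depend on the choices of paths, disk, frame and angles; `0` is only a default value. -/
def maslov (Ω : SymplecticForm M) (φ : M ≃ₘ⟮𝓡 2, 𝓡 2⟯ M) (x p : M) : ℤ :=
  if h : ∃ k, IsMaslovIndex Ω φ x p x k then h.choose else 0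

end Maslov

section Digons

/-- The di-gon `D`: its two vertices `(-1, 0)` and `(1, 0)` are convex corners. -/
def digon : Set Plane := {z | |z 1| ≤ 1 - z 0 ^ 2}

/-- The upper boundary `B_s` of the di-gon. -/
def upperEdge : Set Plane := {z | z ∈ digon ∧ z 1 = 1 - z 0 ^ 2}

/-- The lower boundary `B_u` of the di-gon. -/
def lowerEdge : Set Plane := {z | z ∈ digon ∧ z 1 = -(1 - z 0 ^ 2)}

/-- The vertex `(-1, 0)`. -/
def leftVertex : digon := ⟨!₂[-1, 0], by simp [digon]⟩

/-- The vertex `(1, 0)`. -/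
def rightVertex : digon := ⟨!₂[1, 0], by simp [digon]⟩

/-- `𝓜(p, q)`: the smooth orientation preserving immersed di-gons `v : D → M` with
`v(B_u) ⊆ W^u`, `v(B_s) ⊆ W^s`, `v(-1, 0) = p` and `v(1, 0) = q`. Smooth immersions are taken up to
the boundary and the vertices, through a smooth extension `V` to a neighbourhood of `D`. -/
def immersedDigons [IsManifold (𝓡 2) ∞ M] (Ω : SymplecticForm M) (φ : M ≃ₘ⟮𝓡 2, 𝓡 2⟯ M)
    (x p q : M) : Set (digon → M) :=
  {v | (∃ (V : Plane → M) (U : Set Plane), IsOpen U ∧ digon ⊆ U ∧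
        ContMDiffOn (𝓡 2) (𝓡 2) ∞ V U ∧ (∀ z : digon, V z = v z) ∧
        ∀ z ∈ digon, Function.Injective (mfderiv (𝓡 2) (𝓡 2) V z) ∧
          0 < Ω.form (V z) (mfderiv (𝓡 2) (𝓡 2) V z (!₂[1, 0] : Plane))
            (mfderiv (𝓡 2) (𝓡 2) V z (!₂[0, 1] : Plane))) ∧
      (∀ z : digon, (z : Plane) ∈ lowerEdge → v z ∈ unstableManifold φ x) ∧
      (∀ z : digon, (z : Plane) ∈ upperEdge → v z ∈ stableManifold φ x) ∧
      v leftVertex = p ∧ v rightVertex = q}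

/-- `g : D → D` is smooth up to the boundary, with positive Jacobian. -/
def IsPositiveSmooth (g : digon → digon) : Prop :=
  ∃ (G : Plane → Plane) (U : Set Plane), IsOpen U ∧ digon ⊆ U ∧ ContDiffOn ℝ ∞ G U ∧
    (∀ z : digon, G z = g z) ∧ ∀ z ∈ digon, 0 < (fderiv ℝ G z).det

/-- `G(D)`: the orientation preserving diffeomorphisms of `D` that preserve the vertices. -/
def digonDiffeos : Set (digon ≃ digon) :=
  {g | IsPositiveSmooth g ∧ IsPositiveSmooth g.symm ∧
    g leftVertex = leftVertex ∧ g rightVertex = rightVertex}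

/-- The space `𝓜(p, q) / G(D)` of unparametrised immersed di-gons. -/
def UnparamDigons [IsManifold (𝓡 2) ∞ M] (Ω : SymplecticForm M) (φ : M ≃ₘ⟮𝓡 2, 𝓡 2⟯ M)
    (x p q : M) : Type u :=
  Quot fun v w : immersedDigons Ω φ x p q ↦ ∃ g ∈ digonDiffeos, w.1 = v.1 ∘ g

end Digons

section Signs

/-- `ν` represents an orientation `o_u` of the immersed line `W^u`: it is a nonzero tangent vector
of `W^u` at `x`. -/
def IsOrientation (φ : M ≃ₘ⟮𝓡 2, 𝓡 2⟯ M) (x : M) (ν : TangentSpace (𝓡 2) x) : Prop :=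
  ν ∈ tangentLine (unstableParam φ x) x ∧ ν ≠ 0

/-- `o_pq = o_u`: the segment `[p, q]_u`, directed from `p` to `q`, runs in the direction of the
orientation of `W^u` given by `ν`. -/
def SegmentPositive (φ : M ≃ₘ⟮𝓡 2, 𝓡 2⟯ M) (x : M) (ν : TangentSpace (𝓡 2) x) (p q : M) : Prop :=
  ∃ γ ∈ unstableParam φ x,
    (∃ c : ℝ, 0 < c ∧ velocity γ 0 = (⟨x, c • ν⟩ : TangentBundle (𝓡 2) M)) ∧
    ∃ s t : ℝ, s < t ∧ γ s = p ∧ γ t = q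

open Classical in
/-- The sign `n(p, q)`: it is `1` (or `-1`) if there is an immersed di-gon from `p` to `q` and
`o_pq = o_u` (or `o_pq ≠ o_u`), and `0` if there is none. -/
def sign [IsManifold (𝓡 2) ∞ M] (Ω : SymplecticForm M) (φ : M ≃ₘ⟮𝓡 2, 𝓡 2⟯ M) (x : M)
    (ν : TangentSpace (𝓡 2) x) (p q : M) : ℤ :=
  if Nonempty (UnparamDigons Ω φ x p q) then
    if SegmentPositive φ x ν p q then 1 else -1
  else 0

end Signs

section Complex

variable [IsManifold (𝓡 2) ∞ M] (Ω : SymplecticForm M) (φ : M ≃ₘ⟮𝓡 2, 𝓡 2⟯ M) (x : M)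
  (ν : TangentSpace (𝓡 2) x) (E : Finset M)

/-- The boundary operator `∂^E : ℤE → ℤE`,
`∂^E p = ∑ n(p, q) q` over all `q ∈ E` with `μ(q) = μ(p) - 1`. -/
def boundary : (E →₀ ℤ) →ₗ[ℤ] (E →₀ ℤ) :=
  Finsupp.linearCombination ℤ fun p : E ↦
    ∑ q ∈ Finset.univ.filter (fun q : E ↦ maslov Ω φ x q = maslov Ω φ x p - 1),
      Finsupp.single q (sign Ω φ x ν p q)

/-- `E` is `∂`-complete: `∂^E ∘ ∂^E = 0` on `ℤE`. -/
def IsBoundaryComplete : Prop :=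
  boundary Ω φ x ν E ∘ₗ boundary Ω φ x ν E = 0

/-- `E_k`, the points of `E` with Maslov index `k`. -/
abbrev Level (k : ℤ) : Type u := {p : E // maslov Ω φ x p = k}

/-- The Floer chain group `C_k(E) = ℤE_k`. -/
abbrev Chains (k : ℤ) : Type u := Level Ω φ x E k →₀ ℤ

/-- The inclusion `ℤE_k → ℤE`. -/
def chainIncl (k : ℤ) : Chains Ω φ x E k →ₗ[ℤ] (E →₀ ℤ) :=
  Finsupp.lmapDomain ℤ ℤ Subtype.val

/-- The map `ℤE_i → ℤE_j`, `p ↦ ∑ n(p, q) q` over all `q ∈ E_j`. For `j = i - 1` this is the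
operator `∂^E_i`. -/
def boundaryMap (i j : ℤ) : Chains Ω φ x E i →ₗ[ℤ] Chains Ω φ x E j :=
  Finsupp.linearCombination ℤ fun p : Level Ω φ x E i ↦
    ∑ q : Level Ω φ x E j, Finsupp.single q (sign Ω φ x ν p.1 q.1)

/-- The homology group `H_k(E) = ker ∂^E_k / im ∂^E_{k+1}`. (The pull-back of the image to the
kernel is the image itself as soon as `im ∂^E_{k+1} ⊆ ker ∂^E_k`.) -/
abbrev FloerHomology (k : ℤ) : Type u :=
  LinearMap.ker (boundaryMap Ω φ x ν E k (k - 1)) ⧸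
    (LinearMap.range (boundaryMap Ω φ x ν E (k + 1) k)).submoduleOf
      (LinearMap.ker (boundaryMap Ω φ x ν E k (k - 1)))

/-- The homology `ker ∂^E / im ∂^E` of `(ℤE, ∂^E)`. -/
abbrev UngradedHomology : Type u :=
  LinearMap.ker (boundary Ω φ x ν E) ⧸
    (LinearMap.range (boundary Ω φ x ν E)).submoduleOf (LinearMap.ker (boundary Ω φ x ν E))

end Complex

end HomoclinicFloer

end

/-! The argument is graded linear algebra. The basis `E` is the disjoint union of the fibres of the
Maslov index, so `ℤE` splits into the groups `ℤE_k`. The sum defining `∂^E p` runs only over points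
of index one less, so `∂^E` is homogeneous of degree -1 (`boundary_chainIncl`). Hence the single
relation `∂^E ∘ ∂^E = 0` splits into one relation per degree (`comp_eq_zero`). Homogeneity also
makes the projections to `ℤE_k` commute with the differentials (`proj_differential`). Kernel and
image of `∂^E` are therefore graded, and homology commutes with the decomposition
(`exists_directSum_homology_equiv`). Finally, `exists_homology_equiv` matches categorical homology
with kernel modulo image. -/

/-! ### Categorical homology as kernel modulo image -/

section ModuleCatComplex

open CategoryTheory

universe w v

variable {R : Type*} [Ring R]

/-- The kernel of `homologyπ` of a complex of modules consists of the boundaries. -/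
lemma ChainComplex.homologyπ_eq_zero_iff (C : ChainComplex (ModuleCat.{v} R) ℤ) (k : ℤ)
    (z : C.cycles k) : C.homologyπ k z = 0 ↔ ∃ b : C.X (k + 1), C.toCycles (k + 1) k b = z := by
  constructor
  · exact (ShortComplex.moduleCat_exact_iff _).1 (ShortComplex.exact_of_g_is_cokernel
      (ShortComplex.mk (C.toCycles (k + 1) k) (C.homologyπ k) (by simp))
      (C.homologyIsCokernel (k + 1) k (by simp))) z
  · rintro ⟨b, rfl⟩
    rw [← ModuleCat.comp_apply, C.toCycles_comp_homologyπ]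
    rfl

lemma ChainComplex.exists_iCycles_eq (C : ChainComplex (ModuleCat.{v} R) ℤ) (k : ℤ) (c : C.X k)
    (hc : C.d k (k - 1) c = 0) : ∃ z : C.cycles k, C.iCycles k z = c :=
  (ShortComplex.moduleCat_exact_iff _).1 (ShortComplex.exact_of_f_is_kernel
      (ShortComplex.mk (C.iCycles k) (C.d k (k - 1)) (by simp))
      (C.cyclesIsKernel k (k - 1) (by simp))) c hc

lemma ChainComplex.iCycles_injective (C : ChainComplex (ModuleCat.{v} R) ℤ) (k : ℤ) :
    Function.Injective (C.iCycles k) :=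
  (ModuleCat.mono_iff_injective _).1 inferInstance

lemma ChainComplex.homologyπ_surjective (C : ChainComplex (ModuleCat.{v} R) ℤ) (k : ℤ) :
    Function.Surjective (C.homologyπ k) :=
  (ModuleCat.epi_iff_surjective _).1 inferInstance

variable {N : ℤ → Type w} [∀ k, AddCommGroup (N k)] [∀ k, Module R (N k)]

/-- The homology of a complex of modules, computed as the quotient of the kernel by the image for
an isomorphic sequence of modules in another universe. -/
lemma ChainComplex.exists_homology_equiv (C : ChainComplex (ModuleCat.{v} R) ℤ)
    (d : ∀ i j, N i →ₗ[R] N j) (e : ∀ k, C.X k ≃ₗ[R] N k)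
    (he : ∀ i j, j + 1 = i → ∀ c : C.X i, e j (C.d i j c) = d i j (e i c)) (k : ℤ) :
    ∃ Ψ : C.homology k ≃ₗ[R] LinearMap.ker (d k (k - 1)) ⧸
        (LinearMap.range (d (k + 1) k)).submoduleOf (LinearMap.ker (d k (k - 1))),
      ∀ z : C.cycles k, ∃ hz : e k (C.iCycles k z) ∈ LinearMap.ker (d k (k - 1)),
        Ψ (C.homologyπ k z) = Submodule.Quotient.mk ⟨e k (C.iCycles k z), hz⟩ := by
  have hz (z : C.cycles k) : e k (C.iCycles k z) ∈ LinearMap.ker (d k (k - 1)) := by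
    rw [LinearMap.mem_ker, ← he k (k - 1) (by ring), ← ModuleCat.comp_apply, C.iCycles_d]
    exact map_zero _
  set B := (LinearMap.range (d (k + 1) k)).submoduleOf (LinearMap.ker (d k (k - 1)))
  -- `q` and `homologyπ` are surjections from the same module of cycles; equal kernels identify
  -- their targets.
  let q : C.cycles k →ₗ[R] LinearMap.ker (d k (k - 1)) ⧸ B :=
    B.mkQ ∘ₗ ((e k).toLinearMap ∘ₗ (C.iCycles k).hom).codRestrict _ hz
  have hq : Function.Surjective q := by
    refine B.mkQ_surjective.comp fun c ↦ ?_
    obtain ⟨z, h⟩ := C.exists_iCycles_eq k ((e k).symm c) <| (e (k - 1)).injective <| by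
      rw [he k (k - 1) (by ring), map_zero, LinearEquiv.apply_symm_apply]
      exact c.2
    exact ⟨z, Subtype.ext (show e k (C.iCycles k z) = c by rw [h, LinearEquiv.apply_symm_apply])⟩
  have hker : LinearMap.ker (C.homologyπ k).hom = LinearMap.ker q := by
    ext z
    have h0 : z ∈ LinearMap.ker q ↔ ∃ b, d (k + 1) k b = e k (C.iCycles k z) :=
      Submodule.Quotient.mk_eq_zero B
    rw [h0]
    refine (C.homologyπ_eq_zero_iff k z).trans ⟨?_, ?_⟩
    · rintro ⟨b, rfl⟩
      refine ⟨e (k + 1) b, ?_⟩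
      rw [← he (k + 1) k rfl, ← ModuleCat.comp_apply, C.toCycles_i]
    · rintro ⟨b, hb⟩
      refine ⟨(e (k + 1)).symm b, C.iCycles_injective k ((e k).injective ?_)⟩
      rw [← ModuleCat.comp_apply, C.toCycles_i, he (k + 1) k rfl, LinearEquiv.apply_symm_apply, hb]
  refine ⟨((C.homologyπ k).hom.quotKerEquivOfSurjective (C.homologyπ_surjective k)).symm ≪≫ₗ
    Submodule.quotEquivOfEq _ _ hker ≪≫ₗ q.quotKerEquivOfSurjective hq, fun z ↦ ⟨hz z, ?_⟩⟩
  have h1 : ((C.homologyπ k).hom.quotKerEquivOfSurjective (C.homologyπ_surjective k)).symm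
      (C.homologyπ k z) = Submodule.Quotient.mk z := by
    rw [LinearEquiv.symm_apply_eq]
    rfl
  rw [LinearEquiv.trans_apply, LinearEquiv.trans_apply, h1]
  rfl

/-- A sequence of small modules with maps of square zero, as a chain complex of modules in the
prescribed universe. -/
lemma ChainComplex.exists_of_small [∀ k, Small.{v} (N k)] (d : ∀ i j, N i →ₗ[R] N j)
    (hd : ∀ i j k, j + 1 = i → k + 1 = j → d j k ∘ₗ d i j = 0) :
    ∃ (C : ChainComplex (ModuleCat.{v} R) ℤ) (e : ∀ k, C.X k ≃ₗ[R] N k),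
      ∀ i j, j + 1 = i → ∀ c : C.X i, e j (C.d i j c) = d i j (e i c) := by
  let e (k : ℤ) : Shrink.{v} (N k) ≃ₗ[R] N k := Shrink.linearEquiv R (N k)
  -- The family `d i j` is given for all pairs of degrees and may be nonzero when `j + 1 ≠ i`; the
  -- `if` cuts it down to the shape of a complex.
  refine ⟨{ X := fun k ↦ ModuleCat.of R (Shrink.{v} (N k))
            d := fun i j ↦ if j + 1 = i then
              ModuleCat.ofHom ((e j).symm.toLinearMap ∘ₗ d i j ∘ₗ (e i).toLinearMap) else 0
            shape := fun i j h ↦ if_neg h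
            d_comp_d' := ?_ }, e, ?_⟩
  · intro i j k (hij : j + 1 = i) (hjk : k + 1 = j)
    rw [if_pos hij, if_pos hjk]
    rw [← ModuleCat.ofHom_comp]
    refine ModuleCat.hom_ext (LinearMap.ext fun c ↦ ?_)
    change (e k).symm (d j k (e j ((e j).symm (d i j (e i c))))) = 0
    rw [LinearEquiv.apply_symm_apply, ← LinearMap.comp_apply, hd i j k hij hjk,
      LinearMap.zero_apply, map_zero]
  · intro i j hij c
    simp only [if_pos hij]
    exact (e j).apply_symm_apply _

end ModuleCatComplex

/-! ### Graded modules with a differential of degree -1 -/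

section GradedDifferential

variable {R A : Type*} [Ring R] [AddCommGroup A] [Module R A]
  {N : ℤ → Type*} [∀ k, AddCommGroup (N k)] [∀ k, Module R (N k)]

/-- A grading of the module `A` by modules `N k`, given by inclusions and projections. -/
structure ModuleGrading (ι : ∀ k, N k →ₗ[R] A) (pr : ∀ k, A →ₗ[R] N k) : Prop where
  proj_incl (k : ℤ) (c : N k) : pr k (ι k c) = c
  proj_incl_of_ne {j k : ℤ} (h : j ≠ k) (c : N k) : pr j (ι k c) = 0
  exists_eq_sum (a : A) : ∃ s : Finset ℤ, a = ∑ k ∈ s, ι k (pr k a)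

namespace ModuleGrading

variable {ι : ∀ k, N k →ₗ[R] A} {pr : ∀ k, A →ₗ[R] N k}

lemma incl_injective (G : ModuleGrading ι pr) (k : ℤ) : Function.Injective (ι k) :=
  Function.LeftInverse.injective (G.proj_incl k)

lemma isInternal (G : ModuleGrading ι pr) :
    DirectSum.IsInternal fun k ↦ LinearMap.range (ι k) := by
  constructor
  · refine (injective_iff_map_eq_zero _).2 fun ξ hξ ↦ DFinsupp.ext fun k ↦ ?_
    -- A projection sees only its own component of a sum. A component lies in the range of `ι k`, so
    -- it vanishes once its projection does.
    have key (η : ⨁ k, LinearMap.range (ι k)) :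
        pr k (DirectSum.coeAddMonoidHom (fun k ↦ LinearMap.range (ι k)) η) = pr k (η k) := by
      induction η using DirectSum.induction_on with
      | zero => simp
      | of j x =>
        obtain ⟨x, c, rfl⟩ := x
        rw [DirectSum.coeAddMonoidHom_of]
        by_cases h : k = j
        · subst h
          rw [DirectSum.of_eq_same]
        · rw [DirectSum.of_eq_of_ne _ _ _ h, G.proj_incl_of_ne h]
          simp
      | add x y hx hy => simp only [map_add, DirectSum.add_apply, Submodule.coe_add, hx, hy]
    obtain ⟨c, hc⟩ := (ξ k).2
    have h0 := key ξ
    rw [hξ, map_zero, ← hc, G.proj_incl] at h0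
    exact Subtype.ext (by rw [← hc, ← h0, map_zero]; rfl)
  · intro a
    obtain ⟨s, hs⟩ := G.exists_eq_sum a
    refine ⟨∑ k ∈ s, DirectSum.of (fun k ↦ LinearMap.range (ι k)) k ⟨ι k (pr k a), pr k a, rfl⟩, ?_⟩
    rw [map_sum]
    simp only [DirectSum.coeAddMonoidHom_of]
    exact hs.symm

variable {D : A →ₗ[R] A} {d : ∀ i j, N i →ₗ[R] N j}

/-- By linearity it suffices to test homogeneous elements. On degree `k = i` both sides are `d i j`;
on any other degree both vanish, since `D` lands in degree `k - 1 ≠ j`. -/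
lemma proj_differential (G : ModuleGrading ι pr)
    (hD : ∀ i j, j + 1 = i → ∀ c, D (ι i c) = ι j (d i j c)) {i j : ℤ}
    (hij : j + 1 = i) (a : A) : pr j (D a) = d i j (pr i a) := by
  have key (k : ℤ) (c : N k) : pr j (D (ι k c)) = d i j (pr i (ι k c)) := by
    rw [hD k (k - 1) (by ring)]
    by_cases h : i = k
    · subst h
      obtain rfl : j = i - 1 := by lia
      rw [G.proj_incl, G.proj_incl]
    · rw [G.proj_incl_of_ne (by lia), G.proj_incl_of_ne h, map_zero]
  obtain ⟨s, hs⟩ := G.exists_eq_sum a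
  rw [hs]
  simp only [map_sum, key]

lemma comp_eq_zero (G : ModuleGrading ι pr)
    (hD : ∀ i j, j + 1 = i → ∀ c, D (ι i c) = ι j (d i j c)) (hDD : D ∘ₗ D = 0)
    (i j k : ℤ) (hij : j + 1 = i) (hjk : k + 1 = j) : d j k ∘ₗ d i j = 0 := by
  refine LinearMap.ext fun c ↦ G.incl_injective k ?_
  rw [LinearMap.comp_apply, ← hD j k hjk, ← hD i j hij, ← LinearMap.comp_apply, hDD,
    LinearMap.zero_apply, LinearMap.zero_apply, map_zero]

/-- The homology of a graded module with a differential of degree `-1` is the direct sum of the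
homologies in the single degrees. -/
lemma exists_directSum_homology_equiv (G : ModuleGrading ι pr)
    (hD : ∀ i j, j + 1 = i → ∀ c, D (ι i c) = ι j (d i j c)) :
    ∃ Φ : (⨁ k : ℤ, LinearMap.ker (d k (k - 1)) ⧸
          (LinearMap.range (d (k + 1) k)).submoduleOf (LinearMap.ker (d k (k - 1)))) ≃ₗ[R]
        LinearMap.ker D ⧸ (LinearMap.range D).submoduleOf (LinearMap.ker D),
      ∀ k (c : LinearMap.ker (d k (k - 1))), ∃ hc : ι k c ∈ LinearMap.ker D,
        Φ (DirectSum.lof R ℤ (fun k ↦ LinearMap.ker (d k (k - 1)) ⧸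
          (LinearMap.range (d (k + 1) k)).submoduleOf (LinearMap.ker (d k (k - 1)))) k
            (Submodule.Quotient.mk c)) = Submodule.Quotient.mk ⟨ι k c, hc⟩ := by
  let Z (k : ℤ) := LinearMap.ker (d k (k - 1))
  let B (k : ℤ) : Submodule R (Z k) := (LinearMap.range (d (k + 1) k)).submoduleOf (Z k)
  let B' : Submodule R (LinearMap.ker D) := (LinearMap.range D).submoduleOf (LinearMap.ker D)
  have hι (k : ℤ) (c : N k) (hc : c ∈ Z k) : ι k c ∈ LinearMap.ker D := by
    rw [LinearMap.mem_ker, hD k (k - 1) (by ring), LinearMap.mem_ker.1 hc, map_zero]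
  have hpr (k : ℤ) (a : A) (ha : a ∈ LinearMap.ker D) : pr k a ∈ Z k := by
    rw [LinearMap.mem_ker, ← G.proj_differential hD (by ring), LinearMap.mem_ker.1 ha, map_zero]
  -- Inclusions and projections commute with the differentials, so both descend to the quotients.
  -- These divide by image ∩ kernel, so `D ∘ₗ D = 0` is not needed.
  let f (k : ℤ) : (Z k ⧸ B k) →ₗ[R] (LinearMap.ker D ⧸ B') :=
    (B k).mapQ B' ((ι k).restrict (hι k)) <| by
      rintro c ⟨b, hb⟩
      exact ⟨ι (k + 1) b, (hD (k + 1) k rfl b).trans (congrArg (ι k) hb)⟩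
  let g (k : ℤ) : (LinearMap.ker D ⧸ B') →ₗ[R] (Z k ⧸ B k) :=
    B'.mapQ (B k) ((pr k).restrict (hpr k)) <| by
      rintro a ⟨b, hb⟩
      exact ⟨pr (k + 1) b, (G.proj_differential hD rfl b).symm.trans (congrArg (pr k) hb)⟩
  let F : (⨁ k, Z k ⧸ B k) →ₗ[R] (LinearMap.ker D ⧸ B') := DirectSum.toModule R ℤ _ f
  have hF (k : ℤ) (y : Z k ⧸ B k) : F (DirectSum.lof R ℤ _ k y) = f k y :=
    DirectSum.toModule_lof ..
  -- The maps `g k` together recover every component of an element from its image under `F`, which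
  -- gives injectivity.
  have hgF (k : ℤ) : g k ∘ₗ F = DirectSum.component R ℤ (fun k ↦ Z k ⧸ B k) k := by
    refine DirectSum.linearMap_ext R fun j ↦ LinearMap.ext fun y ↦ ?_
    obtain ⟨c, rfl⟩ := Submodule.Quotient.mk_surjective _ y
    change g k (F _) = _
    rw [hF]
    by_cases h : k = j
    · subst h
      rw [LinearMap.comp_apply, DirectSum.component.lof_self]
      exact congrArg Submodule.Quotient.mk (Subtype.ext (G.proj_incl k c))
    · rw [LinearMap.comp_apply, DirectSum.component.of, dif_neg (Ne.symm h)]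
      exact congrArg Submodule.Quotient.mk
        (Subtype.ext (G.proj_incl_of_ne h c) : _ = (0 : Z k))
  have hinj : Function.Injective F := by
    intro ξ η h
    refine DFinsupp.ext fun k ↦ ?_
    exact (LinearMap.congr_fun (hgF k) ξ).symm.trans
      ((congrArg (g k) h).trans (LinearMap.congr_fun (hgF k) η))
  -- The homogeneous components of a cycle are cycles, so its class is a sum of classes from single
  -- degrees.
  have hsurj : Function.Surjective F := by
    intro y
    obtain ⟨a, rfl⟩ := Submodule.Quotient.mk_surjective _ y
    obtain ⟨s, hs⟩ := G.exists_eq_sum a.1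
    refine ⟨∑ k ∈ s, DirectSum.lof R ℤ (fun k ↦ Z k ⧸ B k) k
      (Submodule.Quotient.mk ⟨pr k a, hpr k a a.2⟩), ?_⟩
    have ha : a = ∑ k ∈ s, (⟨ι k (pr k a), hι k _ (hpr k a a.2)⟩ : LinearMap.ker D) :=
      Subtype.ext (by rw [Submodule.coe_sum]; exact hs)
    rw [map_sum]
    conv_rhs => rw [ha, ← Submodule.mkQ_apply, map_sum]
    exact Finset.sum_congr rfl fun k _ ↦ hF k _
  exact ⟨LinearEquiv.ofBijective F ⟨hinj, hsurj⟩, fun k c ↦ ⟨hι k c c.2, hF k _⟩⟩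

end ModuleGrading

end GradedDifferential

/-! ### The grading of a free module by an integer function on its basis -/

/-- The free module on a finite type is graded by the fibres of a function to `ℤ`. -/
lemma Finsupp.moduleGrading_fibers {X : Type*} [Finite X] (m : X → ℤ) :
    ModuleGrading (R := ℤ) (N := fun k ↦ {p : X // m p = k} →₀ ℤ)
      (fun _ ↦ Finsupp.lmapDomain ℤ ℤ Subtype.val)
      (fun _ ↦ Finsupp.lcomapDomain Subtype.val Subtype.val_injective) := by
  -- Restriction to a fibre followed by extension by zero is multiplication by the indicator
  -- function of the fibre.
  have hincl (k : ℤ) (a : X →₀ ℤ) (p : X) :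
      Finsupp.mapDomain Subtype.val
        (Finsupp.comapDomain (Subtype.val : {p : X // m p = k} → X) a
          Subtype.val_injective.injOn) p = if m p = k then a p else 0 := by
    split_ifs with h
    · exact Finsupp.mapDomain_apply Subtype.val_injective _ (⟨p, h⟩ : {p : X // m p = k})
    · exact Finsupp.mapDomain_of_notMem_range _ _ fun ⟨q, hq⟩ ↦ h (hq ▸ q.2)
  refine ⟨fun k c ↦ ?_, fun {j k} h c ↦ ?_, fun a ↦ ?_⟩
  · exact Finsupp.ext fun p ↦ Finsupp.mapDomain_apply Subtype.val_injective c p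
  · refine Finsupp.ext fun p ↦ Finsupp.mapDomain_of_notMem_range c p.1 ?_
    rintro ⟨q, hq⟩
    exact h (by rw [← p.2, ← q.2, hq])
  · have := Fintype.ofFinite X
    -- Only degrees in the image of `m` have a nonempty fibre, and at `p` the sole contribution
    -- comes from `k = m p`.
    refine ⟨Finset.univ.image m, Finsupp.ext fun p ↦ ?_⟩
    rw [Finsupp.finsetSum_apply]
    refine Eq.trans ?_ (Finset.sum_congr rfl fun k _ ↦ (hincl k a p).symm)
    rw [Finset.sum_ite_eq, if_pos (Finset.mem_image_of_mem m (Finset.mem_univ p))]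

/-! ### The homoclinic Floer complex -/

namespace HomoclinicFloer

universe v

variable {M : Type*} [TopologicalSpace M] [ChartedSpace Plane M] [IsManifold (𝓡 2) ∞ M]
  (Ω : SymplecticForm M) (φ : M ≃ₘ⟮𝓡 2, 𝓡 2⟯ M) (x : M) (ν : TangentSpace (𝓡 2) x) (E : Finset M)

/-- On a basis point `p` of index `i`, the filter `μ(q) = μ(p) - 1` selects exactly the points of
`E_j`, so both sides are the same sum, over a filter and over a subtype. -/
lemma boundary_chainIncl {i j : ℤ} (hij : j + 1 = i) :
    boundary Ω φ x ν E ∘ₗ chainIncl Ω φ x E i =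
      chainIncl Ω φ x E j ∘ₗ boundaryMap Ω φ x ν E i j := by
  refine Finsupp.lhom_ext' fun p ↦ LinearMap.ext_ring ?_
  have hj : maslov Ω φ x p.1 - 1 = j := by rw [p.2]; lia
  simp only [boundary, chainIncl, boundaryMap, LinearMap.comp_apply, Finsupp.lsingle_apply,
    Finsupp.lmapDomain_apply, Finsupp.mapDomain_single, Finsupp.linearCombination_single, one_smul]
  rw [hj, Finsupp.mapDomain_finsetSum]
  simp only [Finsupp.mapDomain_single]
  exact Finset.sum_subtype _ (by simp) fun q : E ↦ Finsupp.single q (sign Ω φ x ν p.1 q)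

lemma moduleGrading_chains :
    ModuleGrading (chainIncl Ω φ x E)
      (fun k ↦ Finsupp.lcomapDomain (Subtype.val : Level Ω φ x E k → E)
        Subtype.val_injective) :=
  Finsupp.moduleGrading_fibers fun p : E ↦ maslov Ω φ x p

open CategoryTheory in
/-- The groups `ℤE_k` form a chain complex of modules in any universe, with homology `H_k(E)`. -/
lemma exists_floerComplex
    (hdd : ∀ i j k, j + 1 = i → k + 1 = j →
      boundaryMap Ω φ x ν E j k ∘ₗ boundaryMap Ω φ x ν E i j = 0) :
    ∃ (C : ChainComplex (ModuleCat.{v} ℤ) ℤ) (e : ∀ k, C.X k ≃ₗ[ℤ] Chains Ω φ x E k),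
      (∀ k (c : C.X k), e (k - 1) (C.d k (k - 1) c) = boundaryMap Ω φ x ν E k (k - 1) (e k c)) ∧
      ∃ Ψ : ∀ k, C.homology k ≃ₗ[ℤ] FloerHomology Ω φ x ν E k,
        ∀ k (z : C.cycles k),
          ∃ hz : e k (C.iCycles k z) ∈ LinearMap.ker (boundaryMap Ω φ x ν E k (k - 1)),
            Ψ k (C.homologyπ k z) = Submodule.Quotient.mk ⟨e k (C.iCycles k z), hz⟩ := by
  -- The groups `ℤE_k` are countable, hence small in every universe.
  obtain ⟨C, e, he⟩ := ChainComplex.exists_of_small.{_, v} (boundaryMap Ω φ x ν E) hdd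
  choose Ψ hΨ using ChainComplex.exists_homology_equiv C (boundaryMap Ω φ x ν E) e he
  exact ⟨C, e, fun k ↦ he k (k - 1) (by ring), Ψ, hΨ⟩

end HomoclinicFloer

open HomoclinicFloer CategoryTheory in
theorem mainTheorem2 {M : Type*} [TopologicalSpace M] [T2Space M] [ChartedSpace Plane M]
    [IsManifold (𝓡 2) ∞ M] (hM : IsPlaneOrClosedOfPosGenus M)
    (Ω : SymplecticForm M) (φ : M ≃ₘ⟮𝓡 2, 𝓡 2⟯ M) (hφ : IsSymplecto Ω φ)
    (x : M) (hx : IsHyperbolicFixedPoint φ x) (htrans : TransverseIntersection φ x)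
    (hW : IsWOrientationPreserving φ x)
    (ν : TangentSpace (𝓡 2) x) (hν : IsOrientation φ x ν)
    (E : Finset M) (hE : ∀ p ∈ E, IsContractible φ x p)
    (hcomplete : IsBoundaryComplete Ω φ x ν E) :
    -- `ℤE` is the direct sum of the groups `ℤE_k`
    (∀ k, Function.Injective (chainIncl Ω φ x E k)) ∧
    DirectSum.IsInternal (fun k : ℤ ↦ LinearMap.range (chainIncl Ω φ x E k)) ∧
    -- `∂^E` maps `ℤE_k` to `ℤE_{k-1}`, and its restriction is `∂^E_k`
    (∀ k, boundary Ω φ x ν E ∘ₗ chainIncl Ω φ x E k =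
      chainIncl Ω φ x E (k - 1) ∘ₗ boundaryMap Ω φ x ν E k (k - 1)) ∧
    -- the groups `ℤE_k` with the maps `∂^E_k` form a chain complex ...
    (∀ k, boundaryMap Ω φ x ν E (k - 1) (k - 1 - 1) ∘ₗ boundaryMap Ω φ x ν E k (k - 1) = 0) ∧
    (∀ k, LinearMap.range (boundaryMap Ω φ x ν E (k + 1) k) ≤
      LinearMap.ker (boundaryMap Ω φ x ν E k (k - 1))) ∧
    (∃ (C : ChainComplex (ModuleCat ℤ) ℤ)
      (e : ∀ k, C.X k ≃ₗ[ℤ] Chains Ω φ x E k),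
      (∀ k (c : C.X k), e (k - 1) (C.d k (k - 1) c) = boundaryMap Ω φ x ν E k (k - 1) (e k c)) ∧
      -- ... whose homology in degree `k` is `H_k(E)`
      ∃ Ψ : ∀ k, C.homology k ≃ₗ[ℤ] FloerHomology Ω φ x ν E k,
        ∀ k (z : C.cycles k),
          ∃ hz : e k (C.iCycles k z) ∈ LinearMap.ker (boundaryMap Ω φ x ν E k (k - 1)),
            Ψ k (C.homologyπ k z) = Submodule.Quotient.mk ⟨e k (C.iCycles k z), hz⟩) ∧
    -- the homology of `(ℤE, ∂^E)` is the direct sum of the groups `H_k(E)`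
    (∃ Φ : (⨁ k : ℤ, FloerHomology Ω φ x ν E k) ≃ₗ[ℤ] UngradedHomology Ω φ x ν E,
      ∀ k (c : LinearMap.ker (boundaryMap Ω φ x ν E k (k - 1))),
        ∃ hc : chainIncl Ω φ x E k c ∈ LinearMap.ker (boundary Ω φ x ν E),
          Φ (DirectSum.lof ℤ ℤ (fun k ↦ FloerHomology Ω φ x ν E k) k (Submodule.Quotient.mk c)) =
            Submodule.Quotient.mk ⟨chainIncl Ω φ x E k c, hc⟩) := by
  have G := moduleGrading_chains Ω φ x E
  have hd {i j : ℤ} (hij : j + 1 = i) := boundary_chainIncl Ω φ x ν E hij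
  have hD (i j : ℤ) (hij : j + 1 = i) (c : Chains Ω φ x E i) :
      boundary Ω φ x ν E (chainIncl Ω φ x E i c) =
        chainIncl Ω φ x E j (boundaryMap Ω φ x ν E i j c) := LinearMap.congr_fun (hd hij) c
  -- `∂`-completeness enters here, split into degrees.
  have hdd := G.comp_eq_zero hD hcomplete
  exact ⟨G.incl_injective, G.isInternal, fun k ↦ hd (by ring),
    fun k ↦ hdd k (k - 1) (k - 1 - 1) (by ring) (by ring),
    fun k ↦ LinearMap.range_le_ker_iff.2 (hdd (k + 1) k (k - 1) rfl (by ring)),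
    exists_floerComplex Ω φ x ν E hdd, G.exists_directSum_homology_equiv hD⟩
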